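/- Fix a first-order language with, for every predicate symbol, a mode (input or output) for each argument position. A goal is a finite sequence of atoms, a program is a finite set of definite clauses $H\leftarrow B_1,\dots,B_n$. For an atom $A$ let $A^{\mathrm{inp}}$ be the atom obtained from $A$ by removing all output arguments. A goal $B_1,\dots,B_n$ is well-moded if every variable in an input position of $B_i$ occurs in an output position of some $B_j$, $j<i$. A clause $H\leftarrow B_1,\dots,B_n$ is well-moded if every variable in an input position of $B_i$ occurs in an input position of $H$ or in an output position of some $B_j$, $j<i$, and every variable in an output position of $H$ occurs in an input position of $H$ or in an output position of some $B_j$. A goal is simply moded if its output positions are filled by pairwise distinct variables and no variable in an input position of $B_i$ occurs in an output position of any $B_j$, $j\ge i$. A clause is simply moded if its body is a simply moded goal and no variable in an input position of $H$ occurs in an output position of the body. A program is well-moded (simply moded) if all its clauses are. A goal $G$ LD-terminates for $P$ if the SLD-tree of $P\cup\{G\}$ under the left-to-right selection rule is finite. An order is an irreflexive, asymmetric, transitive relation $>$; it is well-founded if there is no infinite sequence $a_1>a_2>\cdots$. We write $a=_>b$ if for all $c$: $a>c\iff b>c$ and $c>a\iff c>b$. An order on the extended Herbrand base (the set of all atoms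 modulo renaming of variables) is output-independent if $A^{\mathrm{inp}}=B^{\mathrm{inp}}$ implies $A=_>B$. Given a Herbrand model $I$ of $P$ (a set of ground atoms satisfying all ground instances of the clauses of $P$) and such an order $>$, $P$ is term-acceptable with respect to $>$ and $I$ if for every clause $A\leftarrow B_1,\dots,B_n$ of $P$, every $i$, and every substitution $\theta$ such that $(A\theta)^{\mathrm{inp}}$ and $B_1\theta,\dots,B_{i-1}\theta$ are ground and $I\models B_1\theta\wedge\dots\wedge B_{i-1}\theta$, one has $A\theta>B_i\theta$. Theorem. Let $P$ be a well-moded and simply moded program such that every well-moded and simply moded goal LD-terminates for $P$. Then there exist a Herbrand model $I$ of $P$ and an output-independent well-founded order $>$ on the extended Herbrand base such that $P$ is term-acceptable with respect to $>$ and $I$. -/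

import Mathlib

namespace LogicProg

universe u v

/-- Mode of an argument position: input or output. -/
inductive Mode where
  | inp : Mode
  | out : Mode

/-- A moding assigns a mode to every argument position of every predicate symbol. -/
abbrev Moding (L : FirstOrder.Language.{u, v}) : Type v :=
  (n : ℕ) → L.Relations n → Fin n → Mode

/-- A substitution: it moves only finitely many variables. -/
structure Subst (L : FirstOrder.Language.{u, v}) where
  toFun : ℕ → L.Term ℕ
  finite_dom : {x | toFun x ≠ FirstOrder.Language.Term.var x}.Finite

/-- The variables of a substitution: those it moves and those occurring in their images. -/
def Subst.vars {L : FirstOrder.Language.{u, v}} (θ : Subst L) : Set ℕ :=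
  {x | θ.toFun x ≠ FirstOrder.Language.Term.var x ∨
    ∃ y, θ.toFun y ≠ FirstOrder.Language.Term.var y ∧ x ∈ (θ.toFun y).varFinset}

/-- An atom `p(t₁, …, tₙ)`. -/
structure Atom (L : FirstOrder.Language.{u, v}) where
  arity : ℕ
  rel : L.Relations arity
  args : Fin arity → L.Term ℕ

namespace Atom

variable {L : FirstOrder.Language.{u, v}}

def subst (A : Atom L) (θ : Subst L) : Atom L :=
  ⟨A.arity, A.rel, fun i => (A.args i).subst θ.toFun⟩

/-- Renaming of the variables by a permutation. -/
def rename (A : Atom L) (π : Equiv.Perm ℕ) : Atom L :=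
  ⟨A.arity, A.rel, fun i => (A.args i).relabel π⟩

def vars (A : Atom L) : Set ℕ :=
  {x | ∃ i, x ∈ (A.args i).varFinset}

/-- Variables in the input positions. -/
def inVars (m : Moding L) (A : Atom L) : Set ℕ :=
  {x | ∃ i, m A.arity A.rel i = Mode.inp ∧ x ∈ (A.args i).varFinset}

/-- Variables in the output positions. -/
def outVars (m : Moding L) (A : Atom L) : Set ℕ :=
  {x | ∃ i, m A.arity A.rel i = Mode.out ∧ x ∈ (A.args i).varFinset}

open Classical in
/-- The terms in the input positions, from left to right. -/
noncomputable def inArgs (m : Moding L) (A : Atom L) : List (L.Term ℕ) :=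
  ((List.finRange A.arity).filter (fun i => m A.arity A.rel i = Mode.inp)).map A.args

open Classical in
/-- The terms in the output positions, from left to right. -/
noncomputable def outArgs (m : Moding L) (A : Atom L) : List (L.Term ℕ) :=
  ((List.finRange A.arity).filter (fun i => m A.arity A.rel i = Mode.out)).map A.args

/-- The atom with its output arguments removed: the predicate symbol together with the sequence
of its input arguments. -/
noncomputable def inp (m : Moding L) (A : Atom L) :
    (Σ n : ℕ, L.Relations n) × List (L.Term ℕ) :=
  (⟨A.arity, A.rel⟩, A.inArgs m)

def Ground (A : Atom L) : Prop := A.vars = ∅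

/-- The input part of the atom is ground. -/
def InpGround (m : Moding L) (A : Atom L) : Prop := A.inVars m = ∅

/-- `θ` is a most general unifier of `A` and `B`. -/
def IsMGU (A B : Atom L) (θ : Subst L) : Prop :=
  A.subst θ = B.subst θ ∧
    ∀ σ : Subst L, A.subst σ = B.subst σ →
      ∃ δ : Subst L, ∀ x, σ.toFun x = (θ.toFun x).subst δ.toFun

/-- Two atoms are variants if they differ by a renaming of variables. -/
def variantSetoid (L : FirstOrder.Language.{u, v}) : Setoid (Atom L) where
  r A B := ∃ π : Equiv.Perm ℕ, A.rename π = B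
  iseqv :=
    { refl := fun A => ⟨1, by simp [rename]⟩
      symm := by
        rintro A B ⟨π, rfl⟩
        exact ⟨π⁻¹, by simp [rename, FirstOrder.Language.Term.relabel_relabel]⟩
      trans := by
        rintro A B C ⟨π, rfl⟩ ⟨ρ, rfl⟩
        exact ⟨ρ * π, by simp [rename, Function.comp_def]⟩ }

end Atom

/-- The extended Herbrand base: atoms modulo the variant relation. -/
abbrev ExtHerbrandBase (L : FirstOrder.Language.{u, v}) : Type (max u v) :=
  Quotient (Atom.variantSetoid L)

/-- The class of an atom in the extended Herbrand base. -/
def Atom.toBase {L : FirstOrder.Language.{u, v}} (A : Atom L) : ExtHerbrandBase L :=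
  Quotient.mk (Atom.variantSetoid L) A

/-- A goal (query) is a finite sequence of atoms. -/
abbrev Goal (L : FirstOrder.Language.{u, v}) : Type (max u v) := List (Atom L)

def Goal.subst {L : FirstOrder.Language.{u, v}} (G : Goal L) (θ : Subst L) : Goal L :=
  List.map (fun A => A.subst θ) G

def Goal.vars {L : FirstOrder.Language.{u, v}} (G : Goal L) : Set ℕ :=
  {x | ∃ A ∈ G, x ∈ A.vars}

/-- A definite clause `head ← body`. -/
structure Clause (L : FirstOrder.Language.{u, v}) where
  head : Atom L
  body : Goal L

namespace Clause

variable {L : FirstOrder.Language.{u, v}}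

def vars (c : Clause L) : Set ℕ := c.head.vars ∪ Goal.vars c.body

def rename (c : Clause L) (π : Equiv.Perm ℕ) : Clause L :=
  ⟨c.head.rename π, c.body.map (fun A => A.rename π)⟩

end Clause

/-- A definite program is a finite set of clauses. -/
abbrev Program (L : FirstOrder.Language.{u, v}) : Type (max u v) := Finset (Clause L)

section Moded

variable {L : FirstOrder.Language.{u, v}} (m : Moding L)

/-- Every variable in an input position of an atom of the goal occurs in an output position
of an earlier atom. -/
def Goal.WellModed (G : Goal L) : Prop :=
  ∀ (pre : Goal L) (A : Atom L) (post : Goal L), G = pre ++ A :: post →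
    ∀ x ∈ A.inVars m, ∃ B ∈ pre, x ∈ B.outVars m

/-- Every variable in an input position of a body atom, or in an output position of the head,
occurs in an input position of the head or in an output position of an earlier body atom
(of some body atom, in the case of the head). -/
def Clause.WellModed (c : Clause L) : Prop :=
  (∀ (pre : Goal L) (A : Atom L) (post : Goal L), c.body = pre ++ A :: post →
    ∀ x ∈ A.inVars m, x ∈ c.head.inVars m ∨ ∃ B ∈ pre, x ∈ B.outVars m) ∧
  ∀ x ∈ c.head.outVars m, x ∈ c.head.inVars m ∨ ∃ B ∈ c.body, x ∈ B.outVars m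

def Program.WellModed (P : Program L) : Prop := ∀ c ∈ P, Clause.WellModed m c

/-- The output positions of the goal are filled by pairwise distinct variables, and no variable
in an input position of an atom occurs in an output position of that atom or a later one. -/
def Goal.SimplyModed (G : Goal L) : Prop :=
  (∃ xs : List ℕ, xs.Nodup ∧
    List.flatMap (fun A => A.outArgs m) G = xs.map FirstOrder.Language.Term.var) ∧
  ∀ (pre : Goal L) (A : Atom L) (post : Goal L), G = pre ++ A :: post →
    ∀ x ∈ A.inVars m, ∀ B ∈ A :: post, x ∉ B.outVars m

/-- The body is simply moded, and no variable in an input position of the head occurs in an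
output position of the body. -/
def Clause.SimplyModed (c : Clause L) : Prop :=
  Goal.SimplyModed m c.body ∧ ∀ x ∈ c.head.inVars m, ∀ B ∈ c.body, x ∉ B.outVars m

def Program.SimplyModed (P : Program L) : Prop := ∀ c ∈ P, Clause.SimplyModed m c

end Moded

section Resolution

variable {L : FirstOrder.Language.{u, v}}

/-- The data of a resolution step: the program clause, the variant of it that is used, and the
most general unifier. -/
structure Step (L : FirstOrder.Language.{u, v}) where
  clause : Clause L
  input : Clause L
  mgu : Subst L

/-- `LDDerivation P G ξ Q`: the steps `ξ` (the latest one first) form a finite derivation of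
`P ∪ {G}` under the left-to-right selection rule, and `Q` is its last goal. The clause variants
are standardized apart: each is variable-disjoint from the initial goal and from the clause
variants and unifiers of all earlier steps. -/
inductive LDDerivation (P : Program L) (G : Goal L) : List (Step L) → Goal L → Prop where
  | nil : LDDerivation P G [] G
  | step {ξ : List (Step L)} {A : Atom L} {R : Goal L} (s : Step L) :
      LDDerivation P G ξ (A :: R) →
      s.clause ∈ P →
      (∃ π : Equiv.Perm ℕ, s.input = s.clause.rename π) →
      Disjoint s.input.vars (Goal.vars G) →
      (∀ t ∈ ξ, Disjoint s.input.vars t.input.vars ∧ Disjoint s.input.vars t.mgu.vars) →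
      Atom.IsMGU A s.input.head s.mgu →
      LDDerivation P G (s :: ξ) (Goal.subst (s.input.body ++ R) s.mgu)

/-- `T` is an LD-tree for `P ∪ {G}`. A node is identified with the derivation that leads to it
from the root; every node has exactly one child for every clause of `P` that is applicable to
its selected atom. -/
structure IsLDTree (P : Program L) (G : Goal L) (T : Set (List (Step L))) : Prop where
  root_mem : [] ∈ T
  parent_mem : ∀ s ξ, s :: ξ ∈ T → ξ ∈ T
  derivation : ∀ ξ ∈ T, ∃ Q, LDDerivation P G ξ Q
  child : ∀ ξ ∈ T, ∀ c ∈ P, (∃ s : Step L, s.clause = c ∧ ∃ Q, LDDerivation P G (s :: ξ) Q) →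
    ∃! s : Step L, s.clause = c ∧ s :: ξ ∈ T

/-- `G` LD-terminates for `P`: the LD-tree for `P ∪ {G}` (which is unique up to the choice of
clause variants and unifiers) is finite. -/
def LDTerminates (P : Program L) (G : Goal L) : Prop :=
  ∀ T : Set (List (Step L)), IsLDTree P G T → T.Finite

end Resolution

section Order

variable {S : Type*} (r : S → S → Prop)

/-- A strict order: irreflexive, asymmetric, transitive (`r a b` stands for `a > b`). -/
structure IsOrder : Prop where
  irrefl : ∀ a, ¬ r a a
  asymm : ∀ a b, r a b → ¬ r b a
  trans : ∀ a b c, r a b → r b c → r a c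

/-- There is no infinite descending sequence. -/
def IsWellFoundedOrder : Prop := ¬ ∃ f : ℕ → S, ∀ n, r (f n) (f (n + 1))

/-- `a` and `b` are equal under the order: they stand in the same relation to all elements.
For an irreflexive `r` neither is then greater than the other. -/
def EqUnder (a b : S) : Prop := ∀ c, (r a c ↔ r b c) ∧ (r c a ↔ r c b)

end Order

section Acceptability

variable {L : FirstOrder.Language.{u, v}}

/-- Atoms with the same predicate symbol and input arguments are equal under the order. -/
def OutputIndependent (m : Moding L) (r : ExtHerbrandBase L → ExtHerbrandBase L → Prop) : Prop :=
  ∀ A B : Atom L, A.inp m = B.inp m → EqUnder r A.toBase B.toBase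

/-- `I` is a Herbrand model of `P`: a set of ground atoms in which all ground instances of the
clauses of `P` hold. -/
def IsHerbrandModel (P : Program L) (I : Set (Atom L)) : Prop :=
  (∀ A ∈ I, A.Ground) ∧
  ∀ c ∈ P, ∀ θ : Subst L, (c.head.subst θ).Ground → (∀ B ∈ c.body, (B.subst θ).Ground) →
    (∀ B ∈ c.body, B.subst θ ∈ I) → c.head.subst θ ∈ I

/-- The decrease condition of term-acceptability with respect to the order `r` and the
model `I`. -/
def TermAcceptable (m : Moding L) (P : Program L)
    (r : ExtHerbrandBase L → ExtHerbrandBase L → Prop) (I : Set (Atom L)) : Prop :=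
  ∀ c ∈ P, ∀ (pre : Goal L) (B : Atom L) (post : Goal L), c.body = pre ++ B :: post →
    ∀ θ : Subst L, (c.head.subst θ).InpGround m →
      (∀ C ∈ pre, (C.subst θ).Ground) → (∀ C ∈ pre, C.subst θ ∈ I) →
      r (c.head.subst θ).toBase (B.subst θ).toBase

end Acceptability

end LogicProg

/-!
The model is the least Herbrand model `LeastModel P`, and the order compares atoms with ground input
parts through their input parts: `A` is greater than `B` if a nonempty chain of calls (`CallsInp`)
leads from the input part of `A` to that of `B`. A call leads from the head of a clause instance to
a body atom whose predecessors in the body hold in the least model. Output independence is then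
immediate, since variants of an atom with ground input part have the same input part, and
term-acceptability holds because well-modedness makes the input part of the called atom ground.

The content of the theorem is that the call relation is well-founded (`wellFounded_callsInp`). An
input part from which an infinite chain of calls starts gives a goal consisting of one atom with
these ground inputs and distinct variables as outputs (`Atom.generic`), which is well-moded and
simply moded. From it an infinite LD-derivation is built. Its invariant (`Goal.Diverges`) is that
some instance of the current goal has an atom with an inaccessible input part, all earlier atoms
of the instance being in the least model. If the diverging atom is selected, the goal is resolved
with the clause of a call that preserves inaccessibility; if an earlier atom is selected, with the
clause that puts its instance into the least model (`Goal.Diverges.exists_step`). In both cases the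
invariant passes to the resolvent.

The resolution steps exist because of the modes. In a well-moded and simply moded goal, encoded
recursively as `Goal.ModedFrom`, the selected atom has ground inputs and fresh distinct variables as
outputs, so a most general unifier with a suitable clause head can be written down
(`Atom.exists_isMGU`), and the resolvent is moded again (`LDDerivation.exists_step`). Finally, an
LD-tree that contains the infinite derivation is obtained by choosing clause variants and unifiers
accordingly (`not_ldTerminates_of_forall_exists`), which contradicts termination.
-/

namespace LogicProg

open FirstOrder.Language

universe u v

variable {L : FirstOrder.Language.{u, v}}

/-! ### Substitution in terms and atoms -/

theorem term_subst_congr {f g : ℕ → L.Term ℕ} {t : L.Term ℕ} :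
    t.subst f = t.subst g ↔ ∀ x ∈ t.varFinset, f x = g x := by
  induction t with
  | var x => simp [Term.subst, Term.varFinset]
  | func F ts ih =>
    simp only [Term.subst, Term.varFinset, Finset.mem_biUnion, Finset.mem_univ, true_and,
      Term.func.injEq, heq_eq_eq, funext_iff, ih]
    exact ⟨fun h x ⟨i, hx⟩ => h i x hx, fun h i x hx => h x ⟨i, hx⟩⟩

theorem mem_varFinset_subst {f : ℕ → L.Term ℕ} {t : L.Term ℕ} {x : ℕ} :
    x ∈ (t.subst f).varFinset ↔ ∃ z ∈ t.varFinset, x ∈ (f z).varFinset := by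
  induction t with
  | var y => simp [Term.subst, Term.varFinset]
  | func F ts ih =>
    simp only [Term.subst, Term.varFinset, Finset.mem_biUnion, Finset.mem_univ, true_and, ih]
    exact ⟨fun ⟨i, z, hz, hx⟩ => ⟨z, ⟨i, hz⟩, hx⟩, fun ⟨z, ⟨i, hz⟩, hx⟩ => ⟨i, z, hz, hx⟩⟩

theorem term_subst_subst (f g : ℕ → L.Term ℕ) (t : L.Term ℕ) :
    (t.subst f).subst g = t.subst fun x => (f x).subst g := by
  induction t with
  | var y => rfl
  | func F ts ih => simp [Term.subst, ih]

theorem term_subst_var (t : L.Term ℕ) : t.subst Term.var = t := by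
  induction t with
  | var y => rfl
  | func F ts ih => simp [Term.subst, ih]

theorem term_relabel_eq_subst (π : ℕ → ℕ) (t : L.Term ℕ) :
    t.relabel π = t.subst fun x => Term.var (π x) := by
  induction t with
  | var y => rfl
  | func F ts ih => simp [Term.subst, Term.relabel, ih]

theorem term_subst_eq_self {f : ℕ → L.Term ℕ} {t : L.Term ℕ}
    (h : ∀ x ∈ t.varFinset, f x = Term.var x) : t.subst f = t :=
  (term_subst_congr.2 h).trans (term_subst_var t)

/-- Simultaneous replacement of all variables of an atom. Both substitutions and renamings are
of this form, without any condition of finite support. -/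
def Atom.bind (A : Atom L) (f : ℕ → L.Term ℕ) : Atom L :=
  ⟨A.arity, A.rel, fun i => (A.args i).subst f⟩

theorem Atom.subst_eq_bind (A : Atom L) (θ : Subst L) : A.subst θ = A.bind θ.toFun := rfl

theorem Atom.rename_eq_bind (A : Atom L) (π : Equiv.Perm ℕ) :
    A.rename π = A.bind fun x => Term.var (π x) := by
  simp [Atom.rename, Atom.bind, term_relabel_eq_subst]

theorem Atom.bind_bind (A : Atom L) (f g : ℕ → L.Term ℕ) :
    (A.bind f).bind g = A.bind fun x => (f x).subst g := by
  simp [Atom.bind, term_subst_subst]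

theorem Atom.bind_congr {A : Atom L} {f g : ℕ → L.Term ℕ} (h : ∀ x ∈ A.vars, f x = g x) :
    A.bind f = A.bind g := by
  simp only [Atom.bind, Atom.mk.injEq, heq_eq_eq, true_and]
  exact funext fun i => term_subst_congr.2 fun x hx => h x ⟨i, hx⟩

theorem Atom.mem_vars_bind {A : Atom L} {f : ℕ → L.Term ℕ} {x : ℕ} :
    x ∈ (A.bind f).vars ↔ ∃ z ∈ A.vars, x ∈ (f z).varFinset := by
  simp only [Atom.vars, Atom.bind, Set.mem_ofPred_eq, mem_varFinset_subst]
  exact ⟨fun ⟨i, z, hz, hx⟩ => ⟨z, ⟨i, hz⟩, hx⟩, fun ⟨z, ⟨i, hz⟩, hx⟩ => ⟨i, z, hz, hx⟩⟩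

theorem Atom.mem_inVars_bind {m : Moding L} {A : Atom L} {f : ℕ → L.Term ℕ} {x : ℕ} :
    x ∈ (A.bind f).inVars m ↔ ∃ z ∈ A.inVars m, x ∈ (f z).varFinset := by
  simp only [Atom.inVars, Atom.bind, Set.mem_ofPred_eq, mem_varFinset_subst]
  exact ⟨fun ⟨i, hi, z, hz, hx⟩ => ⟨z, ⟨i, hi, hz⟩, hx⟩,
    fun ⟨z, ⟨i, hi, hz⟩, hx⟩ => ⟨i, hi, z, hz, hx⟩⟩

theorem Atom.mem_outVars_bind {m : Moding L} {A : Atom L} {f : ℕ → L.Term ℕ} {x : ℕ} :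
    x ∈ (A.bind f).outVars m ↔ ∃ z ∈ A.outVars m, x ∈ (f z).varFinset := by
  simp only [Atom.outVars, Atom.bind, Set.mem_ofPred_eq, mem_varFinset_subst]
  exact ⟨fun ⟨i, hi, z, hz, hx⟩ => ⟨z, ⟨i, hi, hz⟩, hx⟩,
    fun ⟨z, ⟨i, hi, hz⟩, hx⟩ => ⟨i, hi, z, hz, hx⟩⟩

theorem Atom.inVars_subset_vars (m : Moding L) (A : Atom L) : A.inVars m ⊆ A.vars :=
  fun _ ⟨i, _, hx⟩ => ⟨i, hx⟩

theorem Atom.outVars_subset_vars (m : Moding L) (A : Atom L) : A.outVars m ⊆ A.vars :=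
  fun _ ⟨i, _, hx⟩ => ⟨i, hx⟩

theorem Atom.finite_vars (A : Atom L) : A.vars.Finite := by
  have : A.vars = ⋃ i, ((A.args i).varFinset : Set ℕ) := by
    ext x; simp [Atom.vars]
  rw [this]
  exact Set.finite_iUnion fun i => Finset.finite_toSet _

theorem Goal.finite_vars (G : Goal L) : (Goal.vars G).Finite := by
  have : Goal.vars G = ⋃ A ∈ {A | A ∈ G}, A.vars := by
    ext x; simp [Goal.vars]
  rw [this]
  exact (List.finite_toSet G).biUnion fun A _ => A.finite_vars

theorem Clause.finite_vars (c : Clause L) : c.vars.Finite :=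
  c.head.finite_vars.union (Goal.finite_vars c.body)

theorem Subst.finite_vars (θ : Subst L) : θ.vars.Finite := by
  have : θ.vars ⊆ {x | θ.toFun x ≠ Term.var x} ∪
      ⋃ y ∈ {x | θ.toFun x ≠ Term.var x}, ((θ.toFun y).varFinset : Set ℕ) := by
    rintro x (hx | ⟨y, hy, hx⟩)
    · exact Or.inl hx
    · exact Or.inr (Set.mem_biUnion (s := {x | θ.toFun x ≠ Term.var x}) hy hx)
  exact (θ.finite_dom.union (θ.finite_dom.biUnion fun y _ => Finset.finite_toSet _)).subset this

/-! ### Input parts -/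

/-- Two atoms have the same input part iff they differ at most in their output arguments. -/
theorem Atom.inp_eq_iff {m : Moding L} {A B : Atom L} :
    A.inp m = B.inp m ↔ ∃ b : Fin A.arity → L.Term ℕ, B = ⟨A.arity, A.rel, b⟩ ∧
      ∀ i, m A.arity A.rel i = Mode.inp → A.args i = b i := by
  obtain ⟨n, r, a⟩ := A
  obtain ⟨n', r', a'⟩ := B
  constructor
  · intro h
    simp only [Atom.inp, Prod.mk.injEq, Sigma.mk.injEq] at h
    obtain ⟨⟨rfl, h1⟩, h2⟩ := h
    obtain rfl := eq_of_heq h1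
    refine ⟨a', rfl, fun i hi => ?_⟩
    simp only [Atom.inArgs, List.map_inj_left] at h2
    exact h2 i (by simpa using hi)
  · rintro ⟨b, hb, h⟩
    simp only [Atom.mk.injEq] at hb
    obtain ⟨rfl, h1, h2⟩ := hb
    obtain rfl := eq_of_heq h1
    obtain rfl := eq_of_heq h2
    simp only [Atom.inp, Atom.inArgs, Prod.mk.injEq, true_and, List.map_inj_left]
    intro i hi
    exact h i (by simpa using hi)

theorem Atom.InpGround.of_inp_eq {m : Moding L} {A B : Atom L} (h : A.inp m = B.inp m)
    (hA : A.InpGround m) : B.InpGround m := by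
  obtain ⟨b, rfl, hb⟩ := Atom.inp_eq_iff.1 h
  refine Set.eq_empty_iff_forall_notMem.2 fun x ⟨i, hi, hx⟩ => ?_
  exact Set.eq_empty_iff_forall_notMem.1 hA x ⟨i, hi, by rw [hb i hi]; exact hx⟩

theorem Atom.InpGround.inp_bind {m : Moding L} {A : Atom L} (hA : A.InpGround m)
    (f : ℕ → L.Term ℕ) : (A.bind f).inp m = A.inp m := by
  refine (Atom.inp_eq_iff.2 ⟨_, rfl, fun i hi => ?_⟩).symm
  refine (term_subst_eq_self fun x hx => ?_).symm
  exact (Set.eq_empty_iff_forall_notMem.1 hA x ⟨i, hi, hx⟩).elim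

/-- Variants of an atom with ground input part have the same input part. -/
theorem Atom.inp_out_toBase {m : Moding L} {A : Atom L} (hA : A.InpGround m) :
    (Quotient.out A.toBase).inp m = A.inp m := by
  obtain ⟨π, h⟩ := (Atom.variantSetoid L).symm (Quotient.mk_out (s := Atom.variantSetoid L) A)
  rw [show Quotient.out A.toBase = A.rename π from h.symm, Atom.rename_eq_bind, hA.inp_bind]

theorem Atom.inpGround_out_toBase {m : Moding L} {A : Atom L} :
    (Quotient.out A.toBase).InpGround m ↔ A.InpGround m := by
  refine ⟨fun h => ?_, fun h => h.of_inp_eq (Atom.inp_out_toBase h).symm⟩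
  obtain ⟨π, hπ⟩ := Quotient.mk_out (s := Atom.variantSetoid L) A
  have hA : (Quotient.out A.toBase).rename π = A := hπ
  rw [Atom.rename_eq_bind] at hA
  have e := h.inp_bind fun x => Term.var (π x)
  rw [hA] at e
  exact h.of_inp_eq e.symm

/-! ### Well-moded and simply moded sequences of atoms -/

/-- Variables in the output positions of the atoms of a goal. -/
def Goal.outVars (m : Moding L) (G : Goal L) : Set ℕ := {x | ∃ A ∈ G, x ∈ A.outVars m}

/-- The atom has pairwise distinct variables outside `V` in its output positions. -/
def Atom.FreshOutputs (m : Moding L) (V : Set ℕ) (A : Atom L) : Prop :=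
  ∃ v : Fin A.arity → ℕ,
    (∀ i, m A.arity A.rel i = Mode.out → A.args i = Term.var (v i) ∧ v i ∉ V) ∧
    Set.InjOn v {i | m A.arity A.rel i = Mode.out}

/-- The goal is well-moded and simply moded relative to a set `V` of variables that are regarded
as produced beforehand: reading from left to right, the input positions of each atom use only
variables produced so far, and its output positions produce new ones. -/
def Goal.ModedFrom (m : Moding L) : Set ℕ → Goal L → Prop
  | _, [] => True
  | V, A :: R => A.inVars m ⊆ V ∧ A.FreshOutputs m V ∧ Goal.ModedFrom m (V ∪ A.outVars m) R

theorem Goal.outVars_cons (m : Moding L) (A : Atom L) (R : Goal L) :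
    Goal.outVars m (A :: R) = A.outVars m ∪ Goal.outVars m R := by
  ext x; simp [Goal.outVars]

theorem Goal.modedFrom_append {m : Moding L} {V : Set ℕ} {G H : Goal L} :
    Goal.ModedFrom m V (G ++ H) ↔
      Goal.ModedFrom m V G ∧ Goal.ModedFrom m (V ∪ Goal.outVars m G) H := by
  induction G generalizing V with
  | nil => simp [Goal.ModedFrom, Goal.outVars]
  | cons A R ih =>
    simp only [List.cons_append, Goal.ModedFrom, ih, Goal.outVars_cons, Set.union_assoc, and_assoc]

theorem Goal.ModedFrom.notMem {m : Moding L} {V : Set ℕ} {G : Goal L}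
    (h : Goal.ModedFrom m V G) {x : ℕ} (hx : x ∈ Goal.outVars m G) : x ∉ V := by
  induction G generalizing V with
  | nil => simp [Goal.outVars] at hx
  | cons A R ih =>
    rw [Goal.outVars_cons] at hx
    obtain ⟨-, ⟨v, hv, -⟩, hR⟩ := h
    rcases hx with ⟨i, hi, hx⟩ | hx
    · obtain ⟨e, hV⟩ := hv i hi
      rw [e] at hx
      simp only [Term.varFinset, Finset.mem_singleton] at hx
      exact hx ▸ hV
    · exact fun hV => ih hR hx (Or.inl hV)

/-- Modedness is preserved by a replacement of variables that maps the variables produced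
beforehand to terms over `W` and renames the variables produced by the goal apart from `W`. -/
theorem Goal.ModedFrom.bind {m : Moding L} {V W : Set ℕ} {G : Goal L} {f : ℕ → L.Term ℕ}
    {ρ : ℕ → ℕ} (h : Goal.ModedFrom m V G) (hV : ∀ x ∈ V, ∀ z ∈ (f x).varFinset, z ∈ W)
    (hf : ∀ x ∈ Goal.outVars m G, f x = Term.var (ρ x) ∧ ρ x ∉ W)
    (hρ : Set.InjOn ρ (Goal.outVars m G)) :
    Goal.ModedFrom m W (G.map fun A => A.bind f) := by
  induction G generalizing V W with
  | nil => trivial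
  | cons A R ih =>
    obtain ⟨hin, ⟨v, hv, hinj⟩, hR⟩ := h
    rw [Goal.outVars_cons] at hf hρ
    have hvA : ∀ i, m A.arity A.rel i = Mode.out → v i ∈ A.outVars m := fun i hi =>
      ⟨i, hi, by simp [(hv i hi).1, Term.varFinset]⟩
    refine ⟨?_, ⟨fun i => ρ (v i), ?_, ?_⟩, ih hR ?_ ?_ ?_⟩
    · intro x hx
      obtain ⟨z, hz, hx⟩ := Atom.mem_inVars_bind.1 hx
      exact hV z (hin hz) x hx
    · intro i hi
      have := hf (v i) (Or.inl (hvA i hi))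
      refine ⟨?_, this.2⟩
      simp only [Atom.bind]
      rw [(hv i hi).1]
      exact this.1
    · intro i hi j hj hij
      exact hinj hi hj (hρ (Or.inl (hvA i hi)) (Or.inl (hvA j hj)) hij)
    · rintro x (hx | hx) z hz
      · exact Or.inl (hV x hx z hz)
      · exact Or.inr (Atom.mem_outVars_bind.2 ⟨x, hx, hz⟩)
    · intro x hx
      refine ⟨(hf x (Or.inr hx)).1, ?_⟩
      rintro (hW | hW)
      · exact (hf x (Or.inr hx)).2 hW
      · obtain ⟨z, hz, hxz⟩ := Atom.mem_outVars_bind.1 hW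
        rw [(hf z (Or.inl hz)).1] at hxz
        simp only [Term.varFinset, Finset.mem_singleton] at hxz
        have := hρ (Or.inr hx) (Or.inl hz) hxz
        exact hR.notMem hx (Or.inr (this ▸ hz))
    · exact hρ.mono Set.subset_union_right

theorem Goal.modedFrom_of_outArgs {m : Moding L} {V : Set ℕ} {G : Goal L} {xs : List ℕ}
    (hin : ∀ (pre : Goal L) (A : Atom L) (post : Goal L), G = pre ++ A :: post →
      ∀ x ∈ A.inVars m, x ∈ V ∨ ∃ B ∈ pre, x ∈ B.outVars m)
    (hxs : xs.Nodup) (hout : List.flatMap (fun A => A.outArgs m) G = xs.map Term.var)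
    (hV : ∀ x ∈ V, ∀ B ∈ G, x ∉ B.outVars m) : Goal.ModedFrom m V G := by
  classical
  induction G generalizing V xs with
  | nil => trivial
  | cons A R ih =>
    rw [List.flatMap_cons, List.append_eq_map_iff] at hout
    obtain ⟨ys, zs, rfl, hys, hzs⟩ := hout
    obtain ⟨hysn, hzsn, hdisj⟩ := List.nodup_append.1 hxs
    have hmem : ∀ i, m A.arity A.rel i = Mode.out → ∃ y ∈ ys, A.args i = Term.var y := by
      intro i hi
      have : A.args i ∈ ys.map (Term.var : ℕ → L.Term ℕ) := by
        rw [hys]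
        exact List.mem_map_of_mem (by simpa using hi)
      obtain ⟨y, hy, e⟩ := List.mem_map.1 this
      exact ⟨y, hy, e.symm⟩
    have hvar : Function.Injective (Term.var : ℕ → L.Term ℕ) := fun x y h => by simpa using h
    have houtys : ∀ x ∈ A.outVars m, x ∈ ys := by
      rintro x ⟨i, hi, hx⟩
      obtain ⟨y, hy, e⟩ := hmem i hi
      rw [e] at hx
      simp only [Term.varFinset, Finset.mem_singleton] at hx
      exact hx ▸ hy
    refine ⟨fun x hx => by simpa using hin [] A R rfl x hx, ?_,
      ih (fun pre B post e x hx => ?_) hzsn hzs.symm ?_⟩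
    · choose! v hv using hmem
      refine ⟨v, fun i hi => ⟨(hv i hi).2, fun h => hV _ h A List.mem_cons_self
        ⟨i, hi, by simp [(hv i hi).2, Term.varFinset]⟩⟩, fun i hi j hj hij => ?_⟩
      have hn : ((List.finRange A.arity).filter
          (fun i => m A.arity A.rel i = Mode.out) |>.map A.args).Nodup := by
        have := hysn.map hvar
        rw [hys] at this
        exact this
      refine List.inj_on_of_nodup_map hn (by simpa using hi) (by simpa using hj) ?_
      rw [(hv i hi).2, (hv j hj).2, hij]
    · rcases hin (A :: pre) B post (by rw [e]; rfl) x hx with h | ⟨C, hC, h⟩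
      · exact Or.inl (Or.inl h)
      · rcases List.mem_cons.1 hC with rfl | hC
        · exact Or.inl (Or.inr h)
        · exact Or.inr ⟨C, hC, h⟩
    · rintro x (hx | hx) B hB hxB
      · exact hV x hx B (List.mem_cons_of_mem _ hB) hxB
      · obtain ⟨i, hi, hxi⟩ := hxB
        have : B.args i ∈ zs.map (Term.var : ℕ → L.Term ℕ) := by
          rw [hzs]
          exact List.mem_flatMap.2 ⟨B, hB, List.mem_map_of_mem (by simpa using hi)⟩
        obtain ⟨z, hz, e⟩ := List.mem_map.1 this
        rw [← e] at hxi
        simp only [Term.varFinset, Finset.mem_singleton] at hxi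
        exact hdisj x (houtys x hx) z hz hxi

theorem Clause.modedFrom_body {m : Moding L} {c : Clause L} (hw : c.WellModed m)
    (hs : c.SimplyModed m) : Goal.ModedFrom m (c.head.inVars m) c.body := by
  obtain ⟨⟨⟨xs, hxs, hout⟩, -⟩, hV⟩ := hs
  exact Goal.modedFrom_of_outArgs hw.1 hxs hout hV

/-! ### Unification -/

/-- For every finite set `F` some renaming moves the variables of a finite set out of `F`. -/
theorem exists_perm_disjoint {S F : Set ℕ} (hS : S.Finite) (hF : F.Finite) :
    ∃ π : Equiv.Perm ℕ, Disjoint (π '' S) F := by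
  obtain ⟨N, hN⟩ := (hS.union hF).bddAbove
  -- The renaming exchanges the blocks `[0, N]` and `[N + 1, 2 * N + 1]`.
  let f : ℕ → ℕ := fun x =>
    if x < N + 1 then x + (N + 1) else if x < 2 * (N + 1) then x - (N + 1) else x
  have hf : Function.Involutive f := by
    intro x
    simp only [f]
    split_ifs <;> omega
  refine ⟨hf.toPerm, Set.disjoint_left.2 ?_⟩
  rintro _ ⟨x, hx, rfl⟩ hxF
  have h1 : x ≤ N := hN (Or.inl hx)
  have h2 : f x ≤ N := hN (Or.inr hxF)
  simp only [f] at h2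
  split_ifs at h2 <;> omega

open Classical in
/-- A unifiable pair of atoms `A` and `H`, where `A` has ground inputs and distinct variables not in
`H` as outputs, has an explicit most general unifier: the input variables of `H` receive their
ground values, and the output variables of `A` the instantiated output terms of `H`. -/
theorem Atom.exists_isMGU {m : Moding L} {A H : Atom L} {τ : Subst L}
    (hA : A.InpGround m) (hout : A.FreshOutputs m H.vars) (hτ : A.subst τ = H.subst τ) :
    ∃ μ : Subst L, Atom.IsMGU A H μ ∧ (∀ x ∈ H.inVars m, μ.toFun x = τ.toFun x) ∧
      (∀ x, x ∉ H.inVars m → x ∉ A.outVars m → μ.toFun x = Term.var x) ∧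
      (∀ x ∈ A.outVars m, ∀ z ∈ (μ.toFun x).varFinset, z ∈ H.outVars m ∧ z ∉ H.inVars m) ∧
      ∀ x, τ.toFun x = (μ.toFun x).subst τ.toFun := by
  obtain ⟨n, r, a⟩ := A
  obtain ⟨n', r', h⟩ := H
  obtain ⟨v, hv, hinj⟩ := hout
  simp only [Atom.subst, Atom.mk.injEq] at hτ
  obtain ⟨rfl, h1, h2⟩ := hτ
  obtain rfl := eq_of_heq h1
  have h3 : ∀ i, (a i).subst τ.toFun = (h i).subst τ.toFun := congrFun (eq_of_heq h2)
  simp only at v hv hinj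
  have haground : ∀ i, m n r i = Mode.inp → ∀ x, x ∉ (a i).varFinset := fun i hi x hx =>
    Set.eq_empty_iff_forall_notMem.1 hA x ⟨i, hi, hx⟩
  have hagr : ∀ i, m n r i = Mode.inp → ∀ f : ℕ → L.Term ℕ, (a i).subst f = a i :=
    fun i hi f => term_subst_eq_self fun x hx => (haground i hi x hx).elim
  set In : Set ℕ := Atom.inVars m ⟨n, r, h⟩ with hIn
  have hτg : ∀ x ∈ In, ∀ z, z ∉ (τ.toFun x).varFinset := by
    rintro x ⟨i, hi, hx⟩ z hz
    have : z ∈ ((h i).subst τ.toFun).varFinset := mem_varFinset_subst.2 ⟨x, hx, hz⟩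
    rw [← h3 i, hagr i hi] at this
    exact haground i hi z this
  let μ₀ : ℕ → L.Term ℕ := fun x => if x ∈ In then τ.toFun x else Term.var x
  let f : ℕ → L.Term ℕ := fun x =>
    if x ∈ In then τ.toFun x
    else if hx : ∃ i, m n r i = Mode.out ∧ v i = x then (h hx.choose).subst μ₀
    else Term.var x
  have hvIn : ∀ i, m n r i = Mode.out → v i ∉ In := fun i hi hx =>
    (hv i hi).2 (Atom.inVars_subset_vars m _ hx)
  have hfIn : ∀ x ∈ In, f x = τ.toFun x := fun x hx => if_pos hx
  have hfv : ∀ i, m n r i = Mode.out → f (v i) = (h i).subst μ₀ := by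
    intro i hi
    have hx : ∃ j, m n r j = Mode.out ∧ v j = v i := ⟨i, hi, rfl⟩
    simp only [f, if_neg (hvIn i hi), dif_pos hx]
    rw [hinj hx.choose_spec.1 hi hx.choose_spec.2]
  have hfvar : ∀ x, x ∉ In → (¬ ∃ i, m n r i = Mode.out ∧ v i = x) → f x = Term.var x :=
    fun x h1 h2 => by simp only [f, if_neg h1, dif_neg h2]
  have hμ₀ : ∀ i, (h i).subst f = (h i).subst μ₀ := by
    intro i
    refine term_subst_congr.2 fun x hx => ?_
    by_cases hxI : x ∈ In
    · rw [hfIn x hxI]; exact (if_pos hxI).symm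
    · rw [hfvar x hxI]
      · exact (if_neg hxI).symm
      · rintro ⟨j, hj, rfl⟩
        exact (hv j hj).2 ⟨i, hx⟩
  have hAout : ∀ x, (∃ i, m n r i = Mode.out ∧ v i = x) ↔ x ∈ Atom.outVars m ⟨n, r, a⟩ := by
    intro x
    constructor
    · rintro ⟨i, hi, rfl⟩
      exact ⟨i, hi, by simp [(hv i hi).1, Term.varFinset]⟩
    · rintro ⟨i, hi, hx⟩
      simp only [(hv i hi).1, Term.varFinset, Finset.mem_singleton] at hx
      exact ⟨i, hi, hx.symm⟩
  -- Every unifier agrees with `τ` on the input variables of `H`, since there it is determined by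
  -- the ground inputs of `A`; hence it absorbs the substitution `f`.
  have key : ∀ σ : Subst L, (∀ i, (a i).subst σ.toFun = (h i).subst σ.toFun) →
      ∀ x, σ.toFun x = (f x).subst σ.toFun := by
    intro σ hσ x
    have hσIn : ∀ x ∈ In, σ.toFun x = τ.toFun x := by
      rintro x ⟨i, hi, hx⟩
      refine term_subst_congr.1 ?_ x hx
      rw [← hσ i, ← h3 i, hagr i hi, hagr i hi]
    by_cases hxI : x ∈ In
    · rw [hfIn x hxI, hσIn x hxI]
      exact (term_subst_eq_self fun z hz => (hτg x hxI z hz).elim).symm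
    · by_cases hxv : ∃ i, m n r i = Mode.out ∧ v i = x
      · obtain ⟨i, hi, rfl⟩ := hxv
        have := hσ i
        rw [(hv i hi).1] at this
        rw [hfv i hi, term_subst_subst]
        refine Eq.trans this (term_subst_congr.2 fun z hz => ?_)
        by_cases hzI : z ∈ In
        · simp only [μ₀, if_pos hzI]
          rw [hσIn z hzI]
          exact (term_subst_eq_self fun w hw => (hτg z hzI w hw).elim).symm
        · simp only [μ₀, if_neg hzI]
          rfl
      · rw [hfvar x hxI hxv]; rfl
  refine ⟨⟨f, ?_⟩, ⟨?_, ?_⟩, hfIn, ?_, ?_, key τ h3⟩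
  · refine ((Atom.finite_vars ⟨n, r, h⟩).union (Atom.finite_vars ⟨n, r, a⟩)).subset ?_
    intro x hx
    by_contra hc
    rw [Set.mem_union, not_or] at hc
    refine hx (hfvar x (fun h => hc.1 (Atom.inVars_subset_vars m _ h)) fun h => hc.2 ?_)
    exact Atom.outVars_subset_vars m _ ((hAout x).1 h)
  · simp only [Atom.subst, Atom.mk.injEq, heq_eq_eq, true_and]
    funext i
    rw [hμ₀ i]
    cases hi : m n r i with
    | inp =>
      rw [hagr i hi, ← hagr i hi τ.toFun, h3 i]
      exact term_subst_congr.2 fun x hx => (if_pos ⟨i, hi, hx⟩).symm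
    | out =>
      rw [(hv i hi).1]
      exact hfv i hi
  · intro σ hσ
    simp only [Atom.subst, Atom.mk.injEq, heq_eq_eq, true_and] at hσ
    exact ⟨σ, key σ (congrFun hσ)⟩
  · intro x h1 h2
    exact hfvar x h1 fun h => h2 ((hAout x).1 h)
  · intro x hx z hz
    obtain ⟨i, hi, rfl⟩ := (hAout x).2 hx
    change z ∈ (f (v i)).varFinset at hz
    rw [hfv i hi] at hz
    obtain ⟨w, hw, hz⟩ := mem_varFinset_subst.1 hz
    by_cases hwI : w ∈ In
    · simp only [μ₀, if_pos hwI] at hz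
      exact (hτg w hwI z hz).elim
    · simp only [μ₀, if_neg hwI, Term.varFinset, Finset.mem_singleton] at hz
      exact hz ▸ ⟨⟨i, hi, hw⟩, hwI⟩

/-! ### Resolution steps that follow a given clause instance -/

open Classical in
/-- If the head of a renamed clause instance has the input part of `A`, some substitution unifies
`A` with the renamed head, acts as the given instance on the clause and, where `A.subst σ` already
is the head instance, acts as `σ` outside the clause. -/
theorem Atom.exists_unifier {m : Moding L} {A : Atom L} {c : Clause L} {θ σ : Subst L}
    {π : Equiv.Perm ℕ} (hA : A.InpGround m) (hinp : A.inp m = (c.head.subst θ).inp m)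
    (hdisj : Disjoint (π '' c.vars) A.vars) (hout : A.FreshOutputs m ∅) :
    ∃ τ : Subst L, (∀ x ∈ c.vars, τ.toFun (π x) = θ.toFun x) ∧
      A.subst τ = (c.head.rename π).subst τ ∧
      (A.subst σ = c.head.subst θ → ∀ x, x ∉ π '' c.vars → τ.toFun x = σ.toFun x) := by
  obtain ⟨b, hb, hab⟩ := Atom.inp_eq_iff.1 hinp
  obtain ⟨v, hv, hinj⟩ := hout
  let f : ℕ → L.Term ℕ := fun x =>
    if x ∈ π '' c.vars then θ.toFun (π.symm x)
    else if hx : ∃ i, m A.arity A.rel i = Mode.out ∧ v i = x then b hx.choose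
    else σ.toFun x
  have hvA : ∀ i, m A.arity A.rel i = Mode.out → v i ∈ A.vars := fun i hi =>
    ⟨i, by simp [(hv i hi).1, Term.varFinset]⟩
  have hvc : ∀ i, m A.arity A.rel i = Mode.out → v i ∉ π '' c.vars := fun i hi h =>
    Set.disjoint_left.1 hdisj h (hvA i hi)
  have hfc : ∀ x ∈ c.vars, f (π x) = θ.toFun x := fun x hx => by
    have : π x ∈ π '' c.vars := ⟨x, hx, rfl⟩
    simp only [f, if_pos this, Equiv.symm_apply_apply]
  have hfv : ∀ i, m A.arity A.rel i = Mode.out → f (v i) = b i := by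
    intro i hi
    have hx : ∃ j, m A.arity A.rel j = Mode.out ∧ v j = v i := ⟨i, hi, rfl⟩
    simp only [f, if_neg (hvc i hi), dif_pos hx]
    rw [hinj hx.choose_spec.1 hi hx.choose_spec.2]
  have hfin : {x | f x ≠ Term.var x}.Finite := by
    refine (((c.finite_vars.image π).union A.finite_vars).union σ.finite_dom).subset fun x hx => ?_
    by_contra hc
    simp only [Set.mem_union, not_or] at hc
    obtain ⟨⟨h1, h2⟩, h3⟩ := hc
    have hxv : ¬ ∃ i, m A.arity A.rel i = Mode.out ∧ v i = x := by
      rintro ⟨i, hi, rfl⟩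
      exact h2 (hvA i hi)
    refine hx ?_
    simp only [f, if_neg h1, dif_neg hxv]
    exact not_not.1 h3
  refine ⟨⟨f, hfin⟩, hfc, ?_, ?_⟩
  · have e : (c.head.rename π).subst ⟨f, hfin⟩ = c.head.subst θ := by
      rw [Atom.rename_eq_bind, Atom.subst_eq_bind, Atom.bind_bind, Atom.subst_eq_bind]
      exact Atom.bind_congr fun x hx => hfc x (Or.inl hx)
    rw [e, hb]
    simp only [Atom.subst, Atom.mk.injEq, heq_eq_eq, true_and]
    funext i
    cases hi : m A.arity A.rel i with
    | inp =>
      rw [← hab i hi]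
      refine term_subst_eq_self fun x hx => ?_
      exact (Set.eq_empty_iff_forall_notMem.1 hA x ⟨i, hi, hx⟩).elim
    | out =>
      rw [(hv i hi).1]
      exact hfv i hi
  · intro hσ x hx
    simp only [f, if_neg hx]
    split_ifs with h
    · obtain ⟨hi, hvi⟩ := h.choose_spec
      rw [hb] at hσ
      simp only [Atom.subst, Atom.mk.injEq, heq_eq_eq, true_and] at hσ
      have := congrFun hσ h.choose
      rw [(hv _ hi).1] at this
      rw [← this, hvi]
      rfl
    · rfl

/-- A goal whose first atom has the input part of a head instance can be resolved with that
clause. The resolvent is again moded, and one substitution `τ` maps its new atoms to the given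
instance of the body and, if the first atom was already instantiated to the head instance by `σ`,
its old atoms to their instances under `σ`. -/
theorem LDDerivation.exists_step {m : Moding L} {P : Program L} {G : Goal L}
    {ξ : List (Step L)} {A : Atom L} {R : Goal L} (hd : LDDerivation P G ξ (A :: R))
    (hQ : Goal.ModedFrom m ∅ (A :: R)) {c : Clause L} (hc : c ∈ P)
    (hbody : Goal.ModedFrom m (c.head.inVars m) c.body)
    (hhead : ∀ x ∈ c.head.outVars m, x ∈ c.head.inVars m ∨ ∃ B ∈ c.body, x ∈ B.outVars m)
    {θ σ : Subst L} (hinp : A.inp m = (c.head.subst θ).inp m) :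
    ∃ (s : Step L) (f g : Atom L → Atom L) (τ : Subst L),
      LDDerivation P G (s :: ξ) (c.body.map f ++ R.map g) ∧
      Goal.ModedFrom m ∅ (c.body.map f ++ R.map g) ∧
      (∀ B ∈ c.body, (f B).subst τ = B.subst θ) ∧
      (A.subst σ = c.head.subst θ → ∀ B ∈ R, (g B).subst τ = B.subst σ) := by
  obtain ⟨hAin, hAout, hR⟩ := hQ
  have hA : A.InpGround m := Set.subset_empty_iff.1 hAin
  let F : Set ℕ := Goal.vars G ∪ Goal.vars (A :: R) ∪
    ⋃ t ∈ {t | t ∈ ξ}, (t.input.vars ∪ t.mgu.vars)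
  have hF : F.Finite := ((Goal.finite_vars G).union (Goal.finite_vars _)).union
    ((List.finite_toSet ξ).biUnion fun t _ => t.input.finite_vars.union t.mgu.finite_vars)
  obtain ⟨π, hπ⟩ := exists_perm_disjoint c.finite_vars hF
  have hcv : (c.rename π).vars = π '' c.vars := by
    ext x
    simp only [Clause.vars, Clause.rename, Goal.vars, Atom.rename_eq_bind, Set.mem_union,
      Set.mem_image, Atom.mem_vars_bind, Term.varFinset, Finset.mem_singleton, Set.mem_ofPred_eq,
      List.mem_map]
    constructor
    · rintro (⟨z, hz, rfl⟩ | ⟨_, ⟨B, hB, rfl⟩, hx⟩)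
      · exact ⟨z, Or.inl hz, rfl⟩
      · obtain ⟨z, hz, hx⟩ := Atom.mem_vars_bind.1 hx
        simp only [Term.varFinset, Finset.mem_singleton] at hx
        exact ⟨z, Or.inr ⟨B, hB, hz⟩, hx.symm⟩
    · rintro ⟨z, hz | ⟨B, hB, hz⟩, rfl⟩
      · exact Or.inl ⟨z, hz, rfl⟩
      · exact Or.inr ⟨_, ⟨B, hB, rfl⟩,
          Atom.mem_vars_bind.2 ⟨z, hz, by simp [Term.varFinset]⟩⟩
  have hπA : ∀ B ∈ A :: R, ∀ x ∈ B.vars, x ∉ π '' c.vars := fun B hB x hx h =>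
    Set.disjoint_left.1 hπ h (Or.inl (Or.inr ⟨B, hB, hx⟩))
  obtain ⟨τ, hτc, hτu, hτσ⟩ := Atom.exists_unifier (σ := σ) hA hinp
    (Set.disjoint_left.2 fun x h hx => hπA A List.mem_cons_self x hx h) hAout
  have hheadv : (c.head.rename π).vars ⊆ π '' c.vars := by
    rw [← hcv]
    exact fun x hx => Or.inl hx
  have hAout' : A.FreshOutputs m (c.head.rename π).vars := by
    obtain ⟨v, hv, hinj⟩ := hAout
    exact ⟨v, fun i hi => ⟨(hv i hi).1, fun h => hπA A List.mem_cons_self _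
      ⟨i, by simp [(hv i hi).1, Term.varFinset]⟩ (hheadv h)⟩, hinj⟩
  obtain ⟨μ, hμ, hμin, hμvar, hμout, hμτ⟩ := Atom.exists_isMGU hA hAout' hτu
  have hin : ∀ x, π x ∈ (c.head.rename π).inVars m ↔ x ∈ c.head.inVars m := by
    intro x
    rw [Atom.rename_eq_bind, Atom.mem_inVars_bind]
    simp [Term.varFinset]
  have hbv : ∀ x ∈ Goal.outVars m c.body, x ∈ c.vars := fun x ⟨B, hB, hx⟩ =>
    Or.inr ⟨B, hB, Atom.outVars_subset_vars m B hx⟩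
  have hμbody : ∀ x ∈ Goal.outVars m c.body, μ.toFun (π x) = Term.var (π x) := by
    intro x hx
    refine hμvar _ (fun h => hbody.notMem hx ((hin x).1 h)) fun h => ?_
    exact hπA A List.mem_cons_self _ (Atom.outVars_subset_vars m A h) ⟨x, hbv x hx, rfl⟩
  have hWπ : ∀ x ∈ Goal.outVars m (c.body.map fun B => B.bind fun x => μ.toFun (π x)),
      x ∈ π '' c.vars := by
    rintro x ⟨_, hC, hx⟩
    obtain ⟨B, hB, rfl⟩ := List.mem_map.1 hC
    obtain ⟨z, hz, hx⟩ := Atom.mem_outVars_bind.1 hx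
    rw [hμbody z ⟨B, hB, hz⟩] at hx
    simp only [Term.varFinset, Finset.mem_singleton] at hx
    exact ⟨z, hbv z ⟨B, hB, hz⟩, hx.symm⟩
  refine ⟨⟨c, c.rename π, μ⟩, fun B => B.bind fun x => μ.toFun (π x), fun B => B.subst μ, τ,
    ?_, ?_, ?_, ?_⟩
  · have h := LDDerivation.step (⟨c, c.rename π, μ⟩ : Step L) hd hc ⟨π, rfl⟩
      (by
        rw [hcv]
        exact hπ.mono_right fun x hx => Or.inl (Or.inl hx))
      (fun t ht => by
        rw [hcv, ← Set.disjoint_union_right]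
        exact hπ.mono_right fun x hx => Or.inr (Set.mem_biUnion (s := {t | t ∈ ξ}) ht hx)) hμ
    have e : Goal.subst ((c.rename π).body ++ R) μ =
        (c.body.map fun B => B.bind fun x => μ.toFun (π x)) ++ R.map fun B => B.subst μ := by
      simp [Goal.subst, Clause.rename, Atom.rename_eq_bind, Atom.subst_eq_bind, Atom.bind_bind,
        Term.subst, Function.comp_def]
    rwa [e] at h
  · refine Goal.modedFrom_append.2 ⟨hbody.bind (ρ := π) ?_ ?_ π.injective.injOn, ?_⟩
    · -- On the input variables of the head, the unifier takes the ground values of `A`.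
      intro x hx z hz
      rw [hμin _ ((hin x).2 hx)] at hz
      rw [hτc x (Or.inl (Atom.inVars_subset_vars m _ hx))] at hz
      have : z ∈ (c.head.subst θ).inVars m := Atom.mem_inVars_bind.2 ⟨x, hx, hz⟩
      rwa [show (c.head.subst θ).inVars m = ∅ from hA.of_inp_eq hinp] at this
    · exact fun x hx => ⟨hμbody x hx, Set.notMem_empty _⟩
    · refine hR.bind (ρ := id) ?_ ?_ Function.injective_id.injOn
      · rintro x (hx | hx) z hz
        · exact hx.elim
        · obtain ⟨h1, h2⟩ := hμout x hx z hz
          rw [Atom.rename_eq_bind] at h1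
          obtain ⟨y, hy, hyz⟩ := Atom.mem_outVars_bind.1 h1
          simp only [Term.varFinset, Finset.mem_singleton] at hyz
          subst hyz
          rcases hhead y hy with h | ⟨B, hB, h⟩
          · exact (h2 ((hin y).2 h)).elim
          · refine Or.inr ⟨_, List.mem_map_of_mem hB, Atom.mem_outVars_bind.2 ⟨y, h, ?_⟩⟩
            rw [hμbody y ⟨B, hB, h⟩]
            simp [Term.varFinset]
      · intro x hx
        have hxR : x ∉ π '' c.vars := by
          obtain ⟨B, hB, hxB⟩ := hx
          exact hπA B (List.mem_cons_of_mem _ hB) x (Atom.outVars_subset_vars m B hxB)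
        refine ⟨hμvar x (fun h => hxR (hheadv (Atom.inVars_subset_vars m _ h)))
          fun h => hR.notMem hx (Or.inr h), ?_⟩
        rintro (h | h)
        · exact h
        · exact hxR (hWπ x h)
  · intro B hB
    rw [Atom.subst_eq_bind, Atom.bind_bind, Atom.subst_eq_bind]
    refine Atom.bind_congr fun x hx => ?_
    rw [← hμτ, hτc x (Or.inr ⟨B, hB, hx⟩)]
  · intro hσ B hB
    simp only [Atom.subst_eq_bind, Atom.bind_bind]
    refine Atom.bind_congr fun x hx => ?_
    rw [← hμτ]
    exact hτσ hσ x (hπA B (List.mem_cons_of_mem _ hB) x hx)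

/-! ### Infinite branches of LD-trees -/

/-- The nodes reached from the root by following, for every clause, the step chosen by `pick`. -/
inductive ChosenTree (P : Program L) (G : Goal L) (pick : List (Step L) → Clause L → Step L) :
    List (Step L) → Prop where
  | nil : ChosenTree P G pick []
  | cons {ξ : List (Step L)} {c : Clause L} : ChosenTree P G pick ξ → c ∈ P →
      (∃ s : Step L, s.clause = c ∧ ∃ Q, LDDerivation P G (s :: ξ) Q) →
      ChosenTree P G pick (pick ξ c :: ξ)

open Classical in
/-- If derivations from `G` with the property `S` can be prolonged forever, `G` does not
LD-terminate: the choice of clause variants and unifiers in an LD-tree can be made so that the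
tree contains an infinite branch of such derivations. -/
theorem not_ldTerminates_of_forall_exists {P : Program L} {G : Goal L}
    {S : List (Step L) → Prop} (hnil : S [])
    (hS : ∀ ξ, S ξ → ∃ s, S (s :: ξ)) (hd : ∀ ξ, S ξ → ∃ Q, LDDerivation P G ξ Q) :
    ¬ LDTerminates P G := by
  have : Nonempty (Step L) := (hS [] hnil).nonempty
  choose! nxt hnxt using hS
  let E : List (Step L) → Clause L → Prop := fun ξ c =>
    ∃ s : Step L, s.clause = c ∧ ∃ Q, LDDerivation P G (s :: ξ) Q
  have hpick : ∀ ξ c, ∃ s : Step L, (E ξ c → s.clause = c ∧ ∃ Q, LDDerivation P G (s :: ξ) Q) ∧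
      (S ξ → (nxt ξ).clause = c → s = nxt ξ) := by
    intro ξ c
    by_cases h : S ξ ∧ (nxt ξ).clause = c
    · exact ⟨nxt ξ, fun _ => ⟨h.2, hd _ (hnxt ξ h.1)⟩, fun _ _ => rfl⟩
    · by_cases hE : E ξ c
      · exact ⟨hE.choose, fun _ => hE.choose_spec, fun h1 h2 => (h ⟨h1, h2⟩).elim⟩
      · exact ⟨nxt ξ, fun h' => (hE h').elim, fun h1 h2 => (h ⟨h1, h2⟩).elim⟩
  choose pick hpick₁ hpick₂ using hpick
  have hT : IsLDTree P G {ξ | ChosenTree P G pick ξ} := by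
    refine ⟨ChosenTree.nil, ?_, ?_, ?_⟩
    · rintro s ξ (_ | ⟨h, -, -⟩)
      exact h
    · rintro ξ (_ | ⟨h, hc, hE⟩)
      · exact ⟨G, LDDerivation.nil⟩
      · exact (hpick₁ _ _ hE).2
    · intro ξ hξ c hc hE
      refine ⟨pick ξ c, ⟨(hpick₁ ξ c hE).1, ChosenTree.cons hξ hc hE⟩, ?_⟩
      rintro s ⟨rfl, hs⟩
      cases hs with
      | cons h hc' hE' => rw [(hpick₁ _ _ hE').1]
  have hlen : ∀ n : ℕ, ∃ ξ, ChosenTree P G pick ξ ∧ S ξ ∧ ξ.length = n := by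
    intro n
    induction n with
    | zero => exact ⟨[], ChosenTree.nil, hnil, rfl⟩
    | succ n ih =>
      obtain ⟨ξ, h1, h2, rfl⟩ := ih
      have hn := hnxt ξ h2
      obtain ⟨Q, hQ⟩ := hd _ hn
      have hc : (nxt ξ).clause ∈ P := by
        cases hQ with
        | step _ _ h _ _ _ _ => exact h
      have := ChosenTree.cons h1 hc ⟨nxt ξ, rfl, Q, hQ⟩
      rw [hpick₂ ξ _ h2 rfl] at this
      exact ⟨_, this, hn, rfl⟩
  intro h
  refine Set.infinite_univ (α := ℕ) (((h _ hT).image List.length).subset fun n _ => ?_)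
  obtain ⟨ξ, h1, -, h3⟩ := hlen n
  exact ⟨ξ, h1, h3⟩

/-! ### Calls in the least Herbrand model -/

/-- The least Herbrand model of a program. -/
inductive LeastModel (P : Program L) : Atom L → Prop where
  | intro (c : Clause L) (θ : Subst L) : c ∈ P → (c.head.subst θ).Ground →
      (∀ B ∈ c.body, (B.subst θ).Ground) → (∀ B ∈ c.body, LeastModel P (B.subst θ)) →
      LeastModel P (c.head.subst θ)

theorem isHerbrandModel_leastModel (P : Program L) :
    IsHerbrandModel P {A | LeastModel P A} :=
  ⟨fun _ h => by cases h; assumption, fun c hc θ h1 h2 h3 => LeastModel.intro c θ hc h1 h2 h3⟩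

/-- `CallsInp m P k k'`: in some instance of a clause of `P`, the head has the ground input part
`k`, a body atom has the input part `k'`, and the body atoms before it hold in the least Herbrand
model. -/
def CallsInp (m : Moding L) (P : Program L) (k k' : (Σ n : ℕ, L.Relations n) × List (L.Term ℕ)) :
    Prop :=
  ∃ c ∈ P, ∃ (pre : Goal L) (B : Atom L) (post : Goal L) (θ : Subst L),
    c.body = pre ++ B :: post ∧ (c.head.subst θ).InpGround m ∧
    (∀ C ∈ pre, LeastModel P (C.subst θ)) ∧
    (c.head.subst θ).inp m = k ∧ (B.subst θ).inp m = k'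

/-- The invariant of the infinite derivation: the goal has an instance in which some atom has an
input part from which infinite chains of calls start, and all earlier atoms hold in the least
Herbrand model. -/
def Goal.Diverges (m : Moding L) (P : Program L) (Q : Goal L) : Prop :=
  ∃ (pre : Goal L) (B : Atom L) (post : Goal L) (σ : Subst L), Q = pre ++ B :: post ∧
    (∀ C ∈ pre, LeastModel P (C.subst σ)) ∧
    ¬ Acc (flip (CallsInp m P)) ((B.subst σ).inp m)

theorem Goal.Diverges.exists_step {m : Moding L} {P : Program L} (hwm : Program.WellModed m P)
    (hsm : Program.SimplyModed m P) {G Q : Goal L} {ξ : List (Step L)}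
    (hd : LDDerivation P G ξ Q) (hQ : Goal.ModedFrom m ∅ Q) (hdiv : Goal.Diverges m P Q) :
    ∃ (s : Step L) (Q' : Goal L), LDDerivation P G (s :: ξ) Q' ∧ Goal.ModedFrom m ∅ Q' ∧
      Goal.Diverges m P Q' := by
  obtain ⟨pre, B, post, σ, rfl, hpre, hB⟩ := hdiv
  cases pre with
  | nil =>
    -- The diverging atom is selected: resolve it with the clause of a diverging call.
    have hBg : B.InpGround m := Set.subset_empty_iff.1 hQ.1
    rw [Atom.subst_eq_bind, hBg.inp_bind] at hB
    obtain ⟨k, hk, hkacc⟩ : ∃ k, CallsInp m P (B.inp m) k ∧ ¬ Acc (flip (CallsInp m P)) k := by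
      by_contra! h
      exact hB ⟨_, fun k hk => h k hk⟩
    obtain ⟨c, hc, pre', B', post', θ, hbody, hg, hpre', hin, rfl⟩ := hk
    obtain ⟨s, f, g, τ, h1, h2, h3, -⟩ := LDDerivation.exists_step (σ := σ) hd hQ hc
      (Clause.modedFrom_body (hwm c hc) (hsm c hc)) (hwm c hc).2 hin.symm
    refine ⟨s, _, h1, h2, pre'.map f, f B', post'.map f ++ post.map g, τ, ?_, ?_, ?_⟩
    · simp [hbody]
    · intro C hC
      obtain ⟨C, hC', rfl⟩ := List.mem_map.1 hC
      rw [h3 C (by simp [hbody, hC'])]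
      exact hpre' C hC'
    · rwa [h3 B' (by simp [hbody])]
  | cons A pre =>
    -- The selected atom has an instance in the least model: resolve it with a clause that
    -- justifies this instance.
    have hAg : A.InpGround m := Set.subset_empty_iff.1 hQ.1
    have hA := hpre A List.mem_cons_self
    generalize hA' : A.subst σ = A' at hA
    obtain ⟨c, θ, hc, hg, hbg, hbody⟩ := hA
    have hin : A.inp m = (c.head.subst θ).inp m := by
      rw [← hA', Atom.subst_eq_bind, hAg.inp_bind]
    obtain ⟨s, f, g, τ, h1, h2, h3, h4⟩ := LDDerivation.exists_step (σ := σ) hd hQ hc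
      (Clause.modedFrom_body (hwm c hc) (hsm c hc)) (hwm c hc).2 hin
    have h5 := h4 hA'
    refine ⟨s, _, h1, h2, c.body.map f ++ pre.map g, g B, post.map g, τ, ?_, ?_, ?_⟩
    · simp
    · intro C hC
      rcases List.mem_append.1 hC with hC | hC
      · obtain ⟨C, hC', rfl⟩ := List.mem_map.1 hC
        rw [h3 C hC']
        exact hbody C hC'
      · obtain ⟨C, hC', rfl⟩ := List.mem_map.1 hC
        rw [h5 C (by simp [hC'])]
        exact hpre C (List.mem_cons_of_mem _ hC')
    · rwa [h5 B (by simp)]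

/-- The most general goal with the input part of `A`: its outputs are distinct variables. -/
noncomputable def Atom.generic (m : Moding L) (A : Atom L) : Atom L :=
  open Classical in
  ⟨A.arity, A.rel, fun i => if m A.arity A.rel i = Mode.inp then A.args i else Term.var i⟩

theorem Atom.inp_generic (m : Moding L) (A : Atom L) : (A.generic m).inp m = A.inp m :=
  (Atom.inp_eq_iff.2 ⟨_, rfl, fun i hi => by simp [hi]⟩).symm

theorem Atom.modes_generic {m : Moding L} {A : Atom L} (hA : A.InpGround m) :
    Goal.WellModed m [A.generic m] ∧ Goal.SimplyModed m [A.generic m] := by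
  classical
  have hg : (A.generic m).inVars m = ∅ := hA.of_inp_eq (Atom.inp_generic m A).symm
  have hin : ∀ (pre : Goal L) (C : Atom L) (post : Goal L), [A.generic m] = pre ++ C :: post →
      ∀ x, x ∉ C.inVars m := by
    intro pre C post h x hx
    have hC : C ∈ [A.generic m] := by rw [h]; simp
    rw [List.mem_singleton.1 hC, hg] at hx
    exact hx
  refine ⟨fun pre C post h x hx => (hin pre C post h x hx).elim, ⟨?_,
    fun pre C post h x hx => (hin pre C post h x hx).elim⟩⟩
  refine ⟨((List.finRange A.arity).filter (fun i => m A.arity A.rel i = Mode.out)).map Fin.val,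
    ((List.nodup_finRange _).filter _).map Fin.val_injective, ?_⟩
  simp only [List.flatMap_cons, List.flatMap_nil, List.append_nil, Atom.outArgs, List.map_map]
  refine List.map_congr_left fun i hi => ?_
  have hi : m A.arity A.rel i = Mode.out := of_decide_eq_true (List.mem_filter.1 hi).2
  simp only [Atom.generic, hi, reduceCtorEq, if_false]
  rfl

theorem wellFounded_callsInp {m : Moding L} {P : Program L} (hwm : Program.WellModed m P)
    (hsm : Program.SimplyModed m P)
    (hterm : ∀ G : Goal L, Goal.WellModed m G → Goal.SimplyModed m G → LDTerminates P G) :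
    WellFounded (flip (CallsInp m P)) := by
  refine ⟨fun k => ?_⟩
  by_contra hk
  -- An inaccessible input part is that of a head instance, as some call starts from it.
  obtain ⟨A, hA, rfl⟩ : ∃ A : Atom L, A.InpGround m ∧ A.inp m = k := by
    by_contra! h
    refine hk ⟨_, fun k' hk' => ?_⟩
    obtain ⟨c, -, -, -, -, θ, -, hg, -, hin, -⟩ := hk'
    exact (h _ hg hin).elim
  obtain ⟨hw, hs⟩ := Atom.modes_generic hA
  obtain ⟨xs, hxs, hout⟩ := hs.1
  have hmod : Goal.ModedFrom m ∅ [A.generic m] :=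
    Goal.modedFrom_of_outArgs (fun pre C post h x hx => Or.inr (hw pre C post h x hx)) hxs hout
      fun x hx => hx.elim
  have hgg : (A.generic m).InpGround m := hA.of_inp_eq (Atom.inp_generic m A).symm
  refine not_ldTerminates_of_forall_exists (P := P) (G := [A.generic m])
    (S := fun ξ => ∃ Q, LDDerivation P [A.generic m] ξ Q ∧ Goal.ModedFrom m ∅ Q ∧
      Goal.Diverges m P Q) ?_ ?_ (fun ξ ⟨Q, h, _⟩ => ⟨Q, h⟩) (hterm _ hw hs)
  · refine ⟨_, LDDerivation.nil, hmod, [], _, [], ⟨Term.var, by simp⟩, rfl, by simp, ?_⟩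
    rwa [Atom.subst_eq_bind, hgg.inp_bind, Atom.inp_generic]
  · rintro ξ ⟨Q, h1, h2, h3⟩
    obtain ⟨s, Q', h⟩ := h3.exists_step hwm hsm h1 h2
    exact ⟨s, Q', h⟩

/-! ### The order on the extended Herbrand base -/

/-- The order on the extended Herbrand base that compares atoms with ground input parts by chains
of calls between their input parts; all other atoms are incomparable. -/
def callOrder (m : Moding L) (P : Program L) (a b : ExtHerbrandBase L) : Prop :=
  (Quotient.out a).InpGround m ∧ (Quotient.out b).InpGround m ∧
    Relation.TransGen (CallsInp m P) ((Quotient.out a).inp m) ((Quotient.out b).inp m)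

theorem callOrder_toBase {m : Moding L} {P : Program L} {A : Atom L} {b : ExtHerbrandBase L} :
    (callOrder m P A.toBase b ↔ A.InpGround m ∧ (Quotient.out b).InpGround m ∧
      Relation.TransGen (CallsInp m P) (A.inp m) ((Quotient.out b).inp m)) ∧
    (callOrder m P b A.toBase ↔ (Quotient.out b).InpGround m ∧ A.InpGround m ∧
      Relation.TransGen (CallsInp m P) ((Quotient.out b).inp m) (A.inp m)) := by
  simp only [callOrder, Atom.inpGround_out_toBase]
  by_cases hA : A.InpGround m
  · simp [hA, Atom.inp_out_toBase hA]
  · simp [hA]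

theorem outputIndependent_callOrder (m : Moding L) (P : Program L) :
    OutputIndependent m (callOrder m P) := by
  intro A B h c
  have hg : A.InpGround m ↔ B.InpGround m :=
    ⟨fun hA => hA.of_inp_eq h, fun hB => hB.of_inp_eq h.symm⟩
  rw [callOrder_toBase.1, callOrder_toBase.1, callOrder_toBase.2, callOrder_toBase.2, h, hg]
  exact ⟨Iff.rfl, Iff.rfl⟩

theorem isWellFoundedOrder_callOrder {m : Moding L} {P : Program L}
    (h : WellFounded (flip (CallsInp m P))) : IsWellFoundedOrder (callOrder m P) := by
  rintro ⟨f, hf⟩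
  have hT : WellFounded (Relation.TransGen (flip (CallsInp m P))) := h.transGen
  refine (wellFounded_iff_isEmpty_descending_chain.1 hT).elim
    ⟨fun n => (Quotient.out (f n)).inp m, fun n => ?_⟩
  exact Relation.transGen_swap.2 (hf n).2.2

theorem termAcceptable_callOrder {m : Moding L} {P : Program L} (hwm : Program.WellModed m P) :
    TermAcceptable m P (callOrder m P) {A | LeastModel P A} := by
  intro c hc pre B post hbody θ hg hpre hI
  have hBg : (B.subst θ).InpGround m := by
    refine Set.eq_empty_iff_forall_notMem.2 fun x hx => ?_
    obtain ⟨z, hz, hx⟩ := Atom.mem_inVars_bind.1 hx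
    rcases (hwm c hc).1 pre B post hbody z hz with h | ⟨C, hC, h⟩
    · exact Set.eq_empty_iff_forall_notMem.1 hg x (Atom.mem_inVars_bind.2 ⟨z, h, hx⟩)
    · exact Set.eq_empty_iff_forall_notMem.1 (hpre C hC) x
        (Atom.mem_vars_bind.2 ⟨z, Atom.outVars_subset_vars m C h, hx⟩)
  rw [callOrder_toBase.1, Atom.inpGround_out_toBase, Atom.inp_out_toBase hBg]
  exact ⟨hg, hBg, Relation.TransGen.single ⟨c, hc, pre, B, post, θ, hbody, hg, hI, rfl, rfl⟩⟩

end LogicProg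

theorem mainTheorem3 {L : FirstOrder.Language} (m : LogicProg.Moding L)
    (P : LogicProg.Program L)
    (hwm : LogicProg.Program.WellModed m P)
    (hsm : LogicProg.Program.SimplyModed m P)
    (hterm : ∀ G : LogicProg.Goal L, LogicProg.Goal.WellModed m G →
      LogicProg.Goal.SimplyModed m G → LogicProg.LDTerminates P G) :
    ∃ (I : Set (LogicProg.Atom L))
      (r : LogicProg.ExtHerbrandBase L → LogicProg.ExtHerbrandBase L → Prop),
      LogicProg.IsHerbrandModel P I ∧
      LogicProg.IsOrder r ∧ LogicProg.IsWellFoundedOrder r ∧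
      LogicProg.OutputIndependent m r ∧
      LogicProg.TermAcceptable m P r I := by
  have hwf := LogicProg.isWellFoundedOrder_callOrder
    (LogicProg.wellFounded_callsInp hwm hsm hterm)
  have htrans : ∀ a b c, LogicProg.callOrder m P a b → LogicProg.callOrder m P b c →
      LogicProg.callOrder m P a c := fun a b c h1 h2 => ⟨h1.1, h2.2.1, h1.2.2.trans h2.2.2⟩
  have hirrefl : ∀ a, ¬ LogicProg.callOrder m P a a := fun a h => hwf ⟨fun _ => a, fun _ => h⟩
  exact ⟨{A | LogicProg.LeastModel P A}, LogicProg.callOrder m P,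
    LogicProg.isHerbrandModel_leastModel P,
    ⟨hirrefl, fun a b h1 h2 => hirrefl a (htrans a b a h1 h2), htrans⟩, hwf,
    LogicProg.outputIndependent_callOrder m P, LogicProg.termAcceptable_callOrder hwm⟩
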